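/- Let $k$ be an algebraically closed field and let $q\in k^\times$ not be a root of unity. Let $D_q$ be the quantum double of the Borel subalgebra $U_q(\mathfrak{sl}_2)^{\le 0}$, that is, the $k$-algebra generated by $E,F,K^{\pm1},\widetilde K^{\pm1}$ with the relations $$KE=q^2EK,\quad KF=q^{-2}FK,\quad \widetilde KE=q^2E\widetilde K,\quad \widetilde KF=q^{-2}F\widetilde K,\quad K\widetilde K=\widetilde KK,$$ $$KK^{-1}=K^{-1}K=1=\widetilde K\widetilde K^{-1}=\widetilde K^{-1}\widetilde K,\qquad EF-FE=\frac{K-\widetilde K^{-1}}{q-q^{-1}},$$ with the comultiplication $$\Delta(E)=E\otimes 1+K\otimes E,\quad \Delta(F)=F\otimes\widetilde K^{-1}+1\otimes F,\quad \Delta(K)=K\otimes K,\quad \Delta(\widetilde K)=\widetilde K\otimes\widetilde K,$$ through which $D_q$ acts on tensor products (over $k$) of $D_q$-modules. For every $z\in k^\times$ fix a square root $\sqrt z\in k^\times$ of $z$. For $z\in k^\times$, an integer $n\ge 0$ and $\epsilon\in\{+1,-1\}$, let $L_z(n,\epsilon)$ be the $(n+1)$-dimensional $D_q$-module with basis $m_0,\dots,m_n$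 and $$Km_i=\epsilon\sqrt z\,q^{n-2i}m_i,\qquad \widetilde Km_i=\epsilon\sqrt z^{\,-1}q^{n-2i}m_i,\qquad Fm_i=m_{i+1},\qquad Em_i=\epsilon\sqrt z\,[i]_q[n+1-i]_q\,m_{i-1},$$ where $m_{-1}=m_{n+1}=0$ and $[j]_q=\frac{q^j-q^{-j}}{q-q^{-1}}$; equivalently, $L_z(n,\epsilon)$ is the pull-back of the simple $U_q(\mathfrak{sl}_2)$-module of dimension $n+1$ with highest weight $\epsilon q^n$ along the algebra homomorphism $D_q\to U_q(\mathfrak{sl}_2)$, $E\mapsto\sqrt z\,E$, $F\mapsto F$, $K\mapsto\sqrt z\,K$, $\widetilde K\mapsto\sqrt z^{\,-1}K$. We write $L_z(n,\pm)$ for $L_z(n,\pm1)$. **Theorem 3.8.** For all $z,z'\in k^\times$ and all integers $m,n\ge 0$ there are isomorphisms of $D_q$-modules $$L_z(m,\pm)\otimes L_{z'}(n,\pm)\cong\begin{cases}\bigoplus_{i=0}^{\min(m,n)}L_{zz'}(m+n-2i,+) & \text{if }\sqrt z\sqrt{z'}=\sqrt{zz'},\\[2pt] \bigoplus_{i=0}^{\min(m,n)}L_{zz'}(m+n-2i,-)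 & \text{if }\sqrt z\sqrt{z'}=-\sqrt{zz'},\end{cases}$$ $$L_z(m,\pm)\otimes L_{z'}(n,\mp)\cong\begin{cases}\bigoplus_{i=0}^{\min(m,n)}L_{zz'}(m+n-2i,-) & \text{if }\sqrt z\sqrt{z'}=\sqrt{zz'},\\[2pt] \bigoplus_{i=0}^{\min(m,n)}L_{zz'}(m+n-2i,+) & \text{if }\sqrt z\sqrt{z'}=-\sqrt{zz'},\end{cases}$$ where in each line the upper signs, respectively the lower signs, are taken together. -/

import Mathlib

open scoped TensorProduct DirectSum

noncomputable section

namespace QuantumDouble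

/-! ### Representations of bialgebras -/

section Representations

variable {k A : Type*} [Field k] [Ring A]

/-- Two representations `ρ : A → End V`, `σ : A → End W` of a `k`-algebra are isomorphic
if there is a `k`-linear bijection `V ≃ W` that commutes with the action of `A`. -/
def RepIso [Algebra k A] {V W : Type*} [AddCommGroup V] [Module k V] [AddCommGroup W] [Module k W]
    (ρ : A →ₐ[k] Module.End k V) (σ : A →ₐ[k] Module.End k W) : Prop :=
  ∃ e : V ≃ₗ[k] W, ∀ (a : A) (v : V), e (ρ a v) = σ a (e v)

/-- The tensor product of two representations of a bialgebra `A`: an element `a` acts on `V ⊗ W`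
through its comultiplication, `a (v ⊗ w) = ∑ a₍₁₎ v ⊗ a₍₂₎ w`. -/
def tensorRep [Bialgebra k A] {V W : Type*} [AddCommGroup V] [Module k V]
    [AddCommGroup W] [Module k W]
    (ρ : A →ₐ[k] Module.End k V) (σ : A →ₐ[k] Module.End k W) :
    A →ₐ[k] Module.End k (V ⊗[k] W) :=
  (Module.endTensorEndAlgHom (R := k) (S := k) (A := k)).comp
    ((Algebra.TensorProduct.map ρ σ).comp (Bialgebra.comulAlgHom k A))

/-- The direct sum of a family of representations. -/
def directSumRep [Algebra k A] {ι : Type*} {V : ι → Type*} [∀ i, AddCommGroup (V i)]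
    [∀ i, Module k (V i)] (ρ : ∀ i, A →ₐ[k] Module.End k (V i)) :
    A →ₐ[k] Module.End k (⨁ i, V i) :=
  AlgHom.ofLinearMap
    { toFun := fun a => DirectSum.lmap fun i => ρ i a
      map_add' := fun a b => by
        refine LinearMap.ext fun x => DFinsupp.ext fun i => ?_
        simp [DirectSum.lmap_apply]
      map_smul' := fun c a => by
        refine LinearMap.ext fun x => DFinsupp.ext fun i => ?_
        simp only [DirectSum.lmap_apply, map_smul, LinearMap.smul_apply, RingHom.id_apply]
        rfl }
    (by
      refine LinearMap.ext fun x => DFinsupp.ext fun i => ?_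
      simp [DirectSum.lmap_apply])
    (fun a b => by
      refine LinearMap.ext fun x => DFinsupp.ext fun i => ?_
      simp [DirectSum.lmap_apply])

end Representations

variable {k : Type*} [Field k]

/-! ### The quantum double `D_q` of the Borel subalgebra of `U_q(sl₂)` -/

/-- The generators `E, F, K, K⁻¹, K̃, K̃⁻¹` of `D_q`. -/
inductive DGen
  | E | F | K | Kinv | Kt | Ktinv

open FreeAlgebra in
/-- The defining relations of `D_q`. -/
inductive DRel (q : kˣ) : FreeAlgebra k DGen → FreeAlgebra k DGen → Prop
  | KE : DRel q (ι k .K * ι k .E) ((q : k) ^ 2 • (ι k .E * ι k .K))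
  | KF : DRel q (ι k .K * ι k .F) ((q : k) ^ (-2 : ℤ) • (ι k .F * ι k .K))
  | KtE : DRel q (ι k .Kt * ι k .E) ((q : k) ^ 2 • (ι k .E * ι k .Kt))
  | KtF : DRel q (ι k .Kt * ι k .F) ((q : k) ^ (-2 : ℤ) • (ι k .F * ι k .Kt))
  | K_Kinv : DRel q (ι k .K * ι k .Kinv) 1
  | Kinv_K : DRel q (ι k .Kinv * ι k .K) 1
  | Kt_Ktinv : DRel q (ι k .Kt * ι k .Ktinv) 1
  | Ktinv_Kt : DRel q (ι k .Ktinv * ι k .Kt) 1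
  | K_Kt : DRel q (ι k .K * ι k .Kt) (ι k .Kt * ι k .K)
  | EF : DRel q (ι k .E * ι k .F - ι k .F * ι k .E)
      (((q : k) - (q : k)⁻¹)⁻¹ • (ι k .K - ι k .Ktinv))

/-- The algebra `D_q`, presented by generators and relations. -/
def D (q : kˣ) : Type _ := RingQuot (DRel q)

instance (q : kˣ) : Ring (D q) := inferInstanceAs (Ring (RingQuot (DRel q)))

instance (q : kˣ) : Algebra k (D q) := inferInstanceAs (Algebra k (RingQuot (DRel q)))

namespace D

/-- The quotient map from the free algebra onto `D_q`. -/
def mk (q : kˣ) : FreeAlgebra k DGen →ₐ[k] D q := RingQuot.mkAlgHom k (DRel q)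

theorem mk_rel {q : kˣ} {x y : FreeAlgebra k DGen} (h : DRel q x y) : mk q x = mk q y :=
  RingQuot.mkAlgHom_rel k h

/-- The image of a generator in `D_q`. -/
def gen (q : kˣ) (g : DGen) : D q := mk q (FreeAlgebra.ι k g)

variable {q : kˣ}

theorem KE : gen q .K * gen q .E = (q : k) ^ 2 • (gen q .E * gen q .K) := by
  simpa only [gen, map_mul, map_smul] using mk_rel (DRel.KE (q := q))

theorem KF : gen q .K * gen q .F = (q : k) ^ (-2 : ℤ) • (gen q .F * gen q .K) := by
  simpa only [gen, map_mul, map_smul] using mk_rel (DRel.KF (q := q))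

theorem KtE : gen q .Kt * gen q .E = (q : k) ^ 2 • (gen q .E * gen q .Kt) := by
  simpa only [gen, map_mul, map_smul] using mk_rel (DRel.KtE (q := q))

theorem KtF : gen q .Kt * gen q .F = (q : k) ^ (-2 : ℤ) • (gen q .F * gen q .Kt) := by
  simpa only [gen, map_mul, map_smul] using mk_rel (DRel.KtF (q := q))

theorem K_Kinv : gen q .K * gen q .Kinv = 1 := by
  simpa only [gen, map_mul, map_one] using mk_rel (DRel.K_Kinv (q := q))

theorem Kinv_K : gen q .Kinv * gen q .K = 1 := by
  simpa only [gen, map_mul, map_one] using mk_rel (DRel.Kinv_K (q := q))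

theorem Kt_Ktinv : gen q .Kt * gen q .Ktinv = 1 := by
  simpa only [gen, map_mul, map_one] using mk_rel (DRel.Kt_Ktinv (q := q))

theorem Ktinv_Kt : gen q .Ktinv * gen q .Kt = 1 := by
  simpa only [gen, map_mul, map_one] using mk_rel (DRel.Ktinv_Kt (q := q))

theorem K_Kt : gen q .K * gen q .Kt = gen q .Kt * gen q .K := by
  simpa only [gen, map_mul] using mk_rel (DRel.K_Kt (q := q))

theorem EF : gen q .E * gen q .F - gen q .F * gen q .E =
    ((q : k) - (q : k)⁻¹)⁻¹ • (gen q .K - gen q .Ktinv) := by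
  simpa only [gen, map_mul, map_sub, map_smul] using mk_rel (DRel.EF (q := q))

/-- The algebra map out of `D_q` with prescribed values on the generators. -/
def lift {A : Type*} [Ring A] [Algebra k A] (f : DGen → A)
    (hKE : f .K * f .E = (q : k) ^ 2 • (f .E * f .K))
    (hKF : f .K * f .F = (q : k) ^ (-2 : ℤ) • (f .F * f .K))
    (hKtE : f .Kt * f .E = (q : k) ^ 2 • (f .E * f .Kt))
    (hKtF : f .Kt * f .F = (q : k) ^ (-2 : ℤ) • (f .F * f .Kt))
    (hK : f .K * f .Kinv = 1) (hK' : f .Kinv * f .K = 1)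
    (hKt : f .Kt * f .Ktinv = 1) (hKt' : f .Ktinv * f .Kt = 1)
    (hKKt : f .K * f .Kt = f .Kt * f .K)
    (hEF : f .E * f .F - f .F * f .E = ((q : k) - (q : k)⁻¹)⁻¹ • (f .K - f .Ktinv)) :
    D q →ₐ[k] A :=
  RingQuot.liftAlgHom k ⟨FreeAlgebra.lift k f, by
    intro x y h
    induction h <;>
      simp only [map_mul, map_sub, map_smul, map_one, FreeAlgebra.lift_ι_apply] <;> assumption⟩

@[simp]
theorem lift_gen {A : Type*} [Ring A] [Algebra k A] (f : DGen → A)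
    (h1 h2 h3 h4 h5 h6 h7 h8 h9 h10) (g : DGen) :
    lift (q := q) f h1 h2 h3 h4 h5 h6 h7 h8 h9 h10 (gen q g) = f g := by
  unfold lift gen
  exact (RingQuot.liftAlgHom_mkAlgHom_apply ..).trans (FreeAlgebra.lift_ι_apply ..)

theorem algHom_ext {A : Type*} [Ring A] [Algebra k A] {φ ψ : D q →ₐ[k] A}
    (h : ∀ g, φ (gen q g) = ψ (gen q g)) : φ = ψ :=
  RingQuot.ringQuot_ext' (S := k) (s := DRel q) φ ψ (FreeAlgebra.hom_ext (funext h))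

/-- The values of the comultiplication of `D_q` on the generators. -/
def comulGen (q : kˣ) : DGen → D q ⊗[k] D q
  | .E => gen q .E ⊗ₜ 1 + gen q .K ⊗ₜ gen q .E
  | .F => gen q .F ⊗ₜ gen q .Ktinv + 1 ⊗ₜ gen q .F
  | .K => gen q .K ⊗ₜ gen q .K
  | .Kinv => gen q .Kinv ⊗ₜ gen q .Kinv
  | .Kt => gen q .Kt ⊗ₜ gen q .Kt
  | .Ktinv => gen q .Ktinv ⊗ₜ gen q .Ktinv

/-- The values of the counit of `D_q` on the generators. -/
def counitGen (k : Type*) [Field k] : DGen → k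
  | .E => 0
  | .F => 0
  | .K => 1
  | .Kinv => 1
  | .Kt => 1
  | .Ktinv => 1

theorem mul_Ktinv {x : D q} {c : k} (h : gen q .Kt * x = c • (x * gen q .Kt)) :
    x * gen q .Ktinv = c • (gen q .Ktinv * x) := by
  calc x * gen q .Ktinv = gen q .Ktinv * (gen q .Kt * x) * gen q .Ktinv := by
        rw [← mul_assoc (gen q .Ktinv), Ktinv_Kt, one_mul]
    _ = c • (gen q .Ktinv * x) := by
      rw [h, mul_smul_comm, smul_mul_assoc, ← mul_assoc, mul_assoc _ (gen q .Kt), Kt_Ktinv, mul_one]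

theorem E_Ktinv : gen q .E * gen q .Ktinv = (q : k) ^ 2 • (gen q .Ktinv * gen q .E) :=
  mul_Ktinv KtE

theorem K_Ktinv : gen q .K * gen q .Ktinv = gen q .Ktinv * gen q .K := by
  simpa using mul_Ktinv (x := gen q .K) (c := 1) (by rw [one_smul, K_Kt])

/-- The comultiplication of `D_q`:
`Δ(E) = E ⊗ 1 + K ⊗ E`, `Δ(F) = F ⊗ K̃⁻¹ + 1 ⊗ F`, and `K`, `K̃` are group-like. -/
def comul (q : kˣ) : D q →ₐ[k] D q ⊗[k] D q :=
  lift (comulGen q)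
    (by
      simp only [comulGen, mul_add, add_mul, Algebra.TensorProduct.tmul_mul_tmul, KE, mul_one,
        one_mul, TensorProduct.tmul_smul, TensorProduct.smul_tmul', smul_add])
    (by
      simp only [comulGen, mul_add, add_mul, Algebra.TensorProduct.tmul_mul_tmul, KF, mul_one,
        one_mul, TensorProduct.tmul_smul, TensorProduct.smul_tmul', smul_add, K_Ktinv])
    (by
      simp only [comulGen, mul_add, add_mul, Algebra.TensorProduct.tmul_mul_tmul, KtE, mul_one,
        one_mul, TensorProduct.tmul_smul, TensorProduct.smul_tmul', smul_add, K_Kt])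
    (by
      simp only [comulGen, mul_add, add_mul, Algebra.TensorProduct.tmul_mul_tmul, KtF, mul_one,
        one_mul, TensorProduct.tmul_smul, TensorProduct.smul_tmul', smul_add, Kt_Ktinv, Ktinv_Kt])
    (by simp only [comulGen, Algebra.TensorProduct.tmul_mul_tmul, K_Kinv,
        Algebra.TensorProduct.one_def])
    (by simp only [comulGen, Algebra.TensorProduct.tmul_mul_tmul, Kinv_K,
        Algebra.TensorProduct.one_def])
    (by simp only [comulGen, Algebra.TensorProduct.tmul_mul_tmul, Kt_Ktinv,
        Algebra.TensorProduct.one_def])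
    (by simp only [comulGen, Algebra.TensorProduct.tmul_mul_tmul, Ktinv_Kt,
        Algebra.TensorProduct.one_def])
    (by simp only [comulGen, Algebra.TensorProduct.tmul_mul_tmul, K_Kt])
    (by
      have h1 : (gen q .K * gen q .F) ⊗ₜ[k] (gen q .E * gen q .Ktinv) =
          (gen q .F * gen q .K) ⊗ₜ[k] (gen q .Ktinv * gen q .E) := by
        rw [KF, E_Ktinv, TensorProduct.tmul_smul, TensorProduct.smul_tmul', smul_smul,
          zpow_neg, ← zpow_natCast]
        simp
      have h2 : gen q .E * gen q .F = gen q .F * gen q .E +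
          ((q : k) - (q : k)⁻¹)⁻¹ • (gen q .K - gen q .Ktinv) := by
        rw [← EF]; abel
      simp only [comulGen, mul_add, add_mul, Algebra.TensorProduct.tmul_mul_tmul, mul_one, one_mul,
        h1]
      rw [h2]
      simp only [TensorProduct.add_tmul, TensorProduct.tmul_add, TensorProduct.tmul_smul,
        TensorProduct.smul_tmul', TensorProduct.sub_tmul, TensorProduct.tmul_sub, smul_sub]
      abel)

/-- The counit of `D_q`. -/
def counit (q : kˣ) : D q →ₐ[k] k :=
  lift (counitGen k) (by simp [counitGen]) (by simp [counitGen]) (by simp [counitGen])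
    (by simp [counitGen]) (by simp [counitGen]) (by simp [counitGen]) (by simp [counitGen])
    (by simp [counitGen]) (by simp [counitGen]) (by simp [counitGen])

theorem comul_gen (g : DGen) : comul q (gen q g) = comulGen q g := by
  unfold comul
  generalize_proofs h1 h2 h3 h4 h5 h6 h7 h8 h9 h10
  exact lift_gen _ h1 h2 h3 h4 h5 h6 h7 h8 h9 h10 g

theorem counit_gen (g : DGen) : counit q (gen q g) = counitGen k g := by
  unfold counit; exact lift_gen ..

instance (q : kˣ) : Bialgebra k (D q) :=
  Bialgebra.ofAlgHom (comul q) (counit q)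
    (algHom_ext fun g => by
      cases g <;>
        simp [comul_gen, comulGen, TensorProduct.add_tmul, TensorProduct.tmul_add, add_assoc,
          Algebra.TensorProduct.one_def])
    (algHom_ext fun g => by
      cases g <;> simp [comul_gen, comulGen, counit_gen, counitGen])
    (algHom_ext fun g => by
      cases g <;> simp [comul_gen, comulGen, counit_gen, counitGen])

end D

/-! ### The quantized enveloping algebra `U_q = U_q(sl₂)` -/

/-- The generators `E, F, K, K⁻¹` of `U_q`. -/
inductive UGen
  | E | F | K | Kinv

open FreeAlgebra in
/-- The defining relations of `U_q`. -/
inductive URel (q : kˣ) : FreeAlgebra k UGen → FreeAlgebra k UGen → Prop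
  | KE : URel q (ι k .K * ι k .E) ((q : k) ^ 2 • (ι k .E * ι k .K))
  | KF : URel q (ι k .K * ι k .F) ((q : k) ^ (-2 : ℤ) • (ι k .F * ι k .K))
  | K_Kinv : URel q (ι k .K * ι k .Kinv) 1
  | Kinv_K : URel q (ι k .Kinv * ι k .K) 1
  | EF : URel q (ι k .E * ι k .F - ι k .F * ι k .E)
      (((q : k) - (q : k)⁻¹)⁻¹ • (ι k .K - ι k .Kinv))

/-- The quantized enveloping algebra `U_q(sl₂)`. -/
def U (q : kˣ) : Type _ := RingQuot (URel q)

instance (q : kˣ) : Ring (U q) := inferInstanceAs (Ring (RingQuot (URel q)))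

instance (q : kˣ) : Algebra k (U q) := inferInstanceAs (Algebra k (RingQuot (URel q)))

namespace U

/-- The quotient map from the free algebra onto `U_q`. -/
def mk (q : kˣ) : FreeAlgebra k UGen →ₐ[k] U q := RingQuot.mkAlgHom k (URel q)

theorem mk_rel {q : kˣ} {x y : FreeAlgebra k UGen} (h : URel q x y) : mk q x = mk q y :=
  RingQuot.mkAlgHom_rel k h

/-- The image of a generator in `U_q`. -/
def gen (q : kˣ) (g : UGen) : U q := mk q (FreeAlgebra.ι k g)

variable {q : kˣ}

theorem KE : gen q .K * gen q .E = (q : k) ^ 2 • (gen q .E * gen q .K) := by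
  simpa only [gen, map_mul, map_smul] using mk_rel (URel.KE (q := q))

theorem KF : gen q .K * gen q .F = (q : k) ^ (-2 : ℤ) • (gen q .F * gen q .K) := by
  simpa only [gen, map_mul, map_smul] using mk_rel (URel.KF (q := q))

theorem K_Kinv : gen q .K * gen q .Kinv = 1 := by
  simpa only [gen, map_mul, map_one] using mk_rel (URel.K_Kinv (q := q))

theorem Kinv_K : gen q .Kinv * gen q .K = 1 := by
  simpa only [gen, map_mul, map_one] using mk_rel (URel.Kinv_K (q := q))

theorem EF : gen q .E * gen q .F - gen q .F * gen q .E =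
    ((q : k) - (q : k)⁻¹)⁻¹ • (gen q .K - gen q .Kinv) := by
  simpa only [gen, map_mul, map_sub, map_smul] using mk_rel (URel.EF (q := q))

/-- The algebra map out of `U_q` with prescribed values on the generators. -/
def lift {A : Type*} [Ring A] [Algebra k A] (f : UGen → A)
    (hKE : f .K * f .E = (q : k) ^ 2 • (f .E * f .K))
    (hKF : f .K * f .F = (q : k) ^ (-2 : ℤ) • (f .F * f .K))
    (hK : f .K * f .Kinv = 1) (hK' : f .Kinv * f .K = 1)
    (hEF : f .E * f .F - f .F * f .E = ((q : k) - (q : k)⁻¹)⁻¹ • (f .K - f .Kinv)) :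
    U q →ₐ[k] A :=
  RingQuot.liftAlgHom k ⟨FreeAlgebra.lift k f, by
    intro x y h
    induction h <;>
      simp only [map_mul, map_sub, map_smul, map_one, FreeAlgebra.lift_ι_apply] <;> assumption⟩

@[simp]
theorem lift_gen {A : Type*} [Ring A] [Algebra k A] (f : UGen → A) (h1 h2 h3 h4 h5) (g : UGen) :
    lift (q := q) f h1 h2 h3 h4 h5 (gen q g) = f g := by
  unfold lift gen
  exact (RingQuot.liftAlgHom_mkAlgHom_apply ..).trans (FreeAlgebra.lift_ι_apply ..)

end U

/-! ### The simple modules -/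

/-- The `q`-number `[j]_q = (q^j - q^{-j}) / (q - q⁻¹)`. -/
def qnum (q : kˣ) (j : ℤ) : k := ((q : k) ^ j - (q : k) ^ (-j)) / ((q : k) - (q : k)⁻¹)

/-- The basis vectors `m_0, …, m_n` of `k^{n+1}`, with the convention `m_i = 0` for `i > n`. -/
def vec (k : Type*) [Field k] (n i : ℕ) : Fin (n + 1) → k :=
  if h : i < n + 1 then Pi.single ⟨i, h⟩ 1 else 0

/-- The linear endomorphism of `k^{n+1}` that sends `m_i` to `f i` for `0 ≤ i ≤ n`. -/
def ofBasis {n : ℕ} (f : ℕ → Fin (n + 1) → k) : Module.End k (Fin (n + 1) → k) :=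
  (Pi.basisFun k (Fin (n + 1))).constr k fun i => f i

/-- The operators by which the generators of `U_q` act on `L(n, ε)`, where `ε = 1` or `ε = -1`:
`K m_i = ε q^{n-2i} m_i`, `F m_i = m_{i+1}` (so that `F m_n = 0`), `E m_0 = 0` and
`E m_i = ε [i]_q [n+1-i]_q m_{i-1}` for `i ≥ 1`. -/
def actU (q : kˣ) (n : ℕ) (ε : ℤˣ) : UGen → Module.End k (Fin (n + 1) → k)
  | .E => ofBasis fun i =>
      if i = 0 then 0 else (((ε : ℤ) : k) * qnum q i * qnum q (n + 1 - i)) • vec k n (i - 1)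
  | .F => ofBasis fun i => vec k n (i + 1)
  | .K => ofBasis fun i => (((ε : ℤ) : k) * (q : k) ^ ((n : ℤ) - 2 * i)) • vec k n i
  | .Kinv => ofBasis fun i => (((ε : ℤ) : k) * (q : k) ^ (-((n : ℤ) - 2 * i))) • vec k n i

theorem ofBasis_vec {n : ℕ} (f : ℕ → Fin (n + 1) → k) {i : ℕ} (hi : i < n + 1) :
    ofBasis f (vec k n i) = f i := by
  have h : vec k n i = Pi.basisFun k (Fin (n + 1)) ⟨i, hi⟩ := by simp [vec, hi]
  rw [h, ofBasis, Module.Basis.constr_basis]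

theorem end_ext {n : ℕ} {S T : Module.End k (Fin (n + 1) → k)}
    (h : ∀ i, i < n + 1 → S (vec k n i) = T (vec k n i)) : S = T := by
  refine (Pi.basisFun k (Fin (n + 1))).ext fun i => ?_
  simpa [vec, i.2] using h i i.2

theorem vec_of_lt {n i : ℕ} (hi : n < i) : vec k n i = 0 := by
  simp [vec, hi.not_ge]

theorem K_vec (q : kˣ) (n : ℕ) (ε : ℤˣ) (i : ℕ) : actU q n ε .K (vec k n i) =
    (((ε : ℤ) : k) * (q : k) ^ ((n : ℤ) - 2 * i)) • vec k n i := by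
  rcases lt_or_ge i (n + 1) with h | h
  · rw [actU, ofBasis_vec _ h]
  · simp [vec_of_lt h]

theorem Kinv_vec (q : kˣ) (n : ℕ) (ε : ℤˣ) (i : ℕ) : actU q n ε .Kinv (vec k n i) =
    (((ε : ℤ) : k) * (q : k) ^ (-((n : ℤ) - 2 * i))) • vec k n i := by
  rcases lt_or_ge i (n + 1) with h | h
  · rw [actU, ofBasis_vec _ h]
  · simp [vec_of_lt h]

theorem F_vec (q : kˣ) (n : ℕ) (ε : ℤˣ) (i : ℕ) :
    actU q n ε .F (vec k n i) = vec k n (i + 1) := by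
  rcases lt_or_ge i (n + 1) with h | h
  · rw [actU, ofBasis_vec _ h]
  · simp [vec_of_lt (k := k) h, vec_of_lt (k := k) (h.trans (Nat.le_succ i))]

theorem E_vec_zero (q : kˣ) (n : ℕ) (ε : ℤˣ) : actU q n ε .E (vec k n 0) = 0 := by
  rw [actU, ofBasis_vec _ n.succ_pos, if_pos rfl]

theorem E_vec_succ (q : kˣ) (n : ℕ) (ε : ℤˣ) (i : ℕ) : actU q n ε .E (vec k n (i + 1)) =
    (((ε : ℤ) : k) * qnum q (i + 1) * qnum q (n - i)) • vec k n i := by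
  rcases lt_or_ge (i + 1) (n + 1) with h | h
  · rw [actU, ofBasis_vec _ h]
    simp
  · rcases (Nat.le_of_succ_le_succ h).eq_or_lt with rfl | h'
    · simp [vec_of_lt (k := k) h, qnum]
    · simp [vec_of_lt (k := k) h, vec_of_lt (k := k) h']

theorem sign_mul_self (ε : ℤˣ) : ((ε : ℤ) : k) * ((ε : ℤ) : k) = 1 := by
  rcases Int.units_eq_one_or ε with rfl | rfl <;> simp

theorem qnum_identity (q : kˣ) (n i : ℤ) :
    qnum q (i + 1) * qnum q (n - i) - qnum q i * qnum q (n + 1 - i) =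
      ((q : k) - (q : k)⁻¹)⁻¹ * ((q : k) ^ (n - 2 * i) - (q : k) ^ (-(n - 2 * i))) := by
  have hq : (q : k) ≠ 0 := q.ne_zero
  by_cases hd : (q : k) - (q : k)⁻¹ = 0
  · simp [qnum, hd]
  have e1 : (q : k) ^ (n - 2 * i) = (q : k) ^ n * ((q : k) ^ i)⁻¹ * ((q : k) ^ i)⁻¹ := by
    rw [zpow_sub₀ hq, two_mul, zpow_add₀ hq]; field_simp
  have hn : (q : k) ^ n ≠ 0 := zpow_ne_zero _ hq
  have hi : (q : k) ^ i ≠ 0 := zpow_ne_zero _ hq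
  simp only [qnum, zpow_neg, e1]
  rw [show n + 1 - i = n - i + 1 by ring]
  simp only [zpow_add₀ hq, zpow_sub₀ hq, zpow_one]
  generalize (q : k) ^ n = a at *
  generalize (q : k) ^ i = b at *
  generalize (q : k) = c at *
  have hc : c - c⁻¹ = (c ^ 2 - 1) / c := by field_simp
  have hc2 : c ^ 2 - 1 ≠ 0 := fun h => hd (by rw [hc, h, zero_div])
  rw [hc]
  field_simp
  ring

/-- The `(n+1)`-dimensional simple `U_q`-module `L(n, ε)` with highest weight `ε q^n`,
where `ε = 1` or `ε = -1`. -/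
def repU (q : kˣ) (n : ℕ) (ε : ℤˣ) : U q →ₐ[k] Module.End k (Fin (n + 1) → k) :=
  U.lift (actU q n ε)
    (end_ext fun i _ => by
      have hq : (q : k) ≠ 0 := q.ne_zero
      rcases i with _ | i
      · simp [K_vec, E_vec_zero]
      · simp only [Module.End.mul_apply, LinearMap.smul_apply, E_vec_succ, K_vec, map_smul,
          smul_smul]
        congr 1
        rw [show (n : ℤ) - 2 * (i : ℕ) = (n - 2 * ((i + 1 : ℕ) : ℤ)) + 2 by push_cast; ring,
          zpow_add₀ hq, zpow_ofNat]
        ring)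
    (end_ext fun i _ => by
      have hq : (q : k) ≠ 0 := q.ne_zero
      simp only [Module.End.mul_apply, LinearMap.smul_apply, F_vec, K_vec, map_smul, smul_smul]
      congr 1
      rw [show (n : ℤ) - 2 * ((i + 1 : ℕ) : ℤ) = (n - 2 * (i : ℤ)) + (-2) by push_cast; ring,
        zpow_add₀ hq]
      ring)
    (end_ext fun i _ => by
      have hq : (q : k) ≠ 0 := q.ne_zero
      simp only [Module.End.mul_apply, Module.End.one_apply, K_vec, Kinv_vec, map_smul, smul_smul]
      rw [mul_mul_mul_comm, sign_mul_self, ← zpow_add₀ hq]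
      simp)
    (end_ext fun i _ => by
      have hq : (q : k) ≠ 0 := q.ne_zero
      simp only [Module.End.mul_apply, Module.End.one_apply, K_vec, Kinv_vec, map_smul, smul_smul]
      rw [mul_mul_mul_comm, sign_mul_self, ← zpow_add₀ hq]
      simp)
    (end_ext fun i _ => by
      have key := qnum_identity q n i
      simp only [LinearMap.sub_apply, Module.End.mul_apply, LinearMap.smul_apply, F_vec, K_vec,
        Kinv_vec, E_vec_succ, ← sub_smul, smul_smul]
      rcases i with _ | i
      · simp only [E_vec_zero, map_zero, sub_zero]
        congr 1
        simp only [Nat.cast_zero, qnum] at key ⊢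
        simp only [zpow_zero, neg_zero, sub_self, zero_div, zero_mul, sub_zero] at key
        rw [mul_assoc, sub_zero, key]
        ring
      · simp only [E_vec_succ, map_smul, F_vec, ← sub_smul]
        congr 1
        rw [show (n : ℤ) + 1 - ((i + 1 : ℕ) : ℤ) = n - i by push_cast; ring,
          show (((i + 1 : ℕ) : ℤ)) = (i : ℤ) + 1 by push_cast; ring] at key
        push_cast
        linear_combination ((ε : ℤ) : k) * key)

/-- The algebra map `π⁺ : D_q → U_q` attached to a chosen square root `w` of `z`:
`E ↦ w E`, `F ↦ F`, `K ↦ w K`, `K̃ ↦ w⁻¹ K`. -/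
def piPlus (q w : kˣ) : D q →ₐ[k] U q :=
  D.lift
    (fun
      | .E => (w : k) • U.gen q .E
      | .F => U.gen q .F
      | .K => (w : k) • U.gen q .K
      | .Kinv => (w : k)⁻¹ • U.gen q .Kinv
      | .Kt => (w : k)⁻¹ • U.gen q .K
      | .Ktinv => (w : k) • U.gen q .Kinv)
    (by simp only [smul_mul_smul_comm, U.KE]; rw [smul_comm])
    (by simp only [smul_mul_assoc, mul_smul_comm, U.KF]; rw [smul_comm])
    (by simp only [smul_mul_smul_comm, U.KE]; rw [smul_comm, mul_comm])
    (by simp only [smul_mul_assoc, mul_smul_comm, U.KF]; rw [smul_comm])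
    (by simp [U.K_Kinv])
    (by simp [U.Kinv_K])
    (by simp [U.K_Kinv])
    (by simp [U.Kinv_K])
    (by simp only [smul_mul_smul_comm]; rw [mul_comm (w : k)])
    (by
      simp only [smul_mul_assoc, mul_smul_comm]
      rw [← smul_sub, ← smul_sub, U.EF, smul_comm])

/-- The `D_q`-module `L_z(n, ε)` (`ε = 1` or `ε = -1`): the pull-back of the `U_q`-module `L(n, ε)`
along `π_z⁺`, where `sqrt` is the chosen square root function on the nonzero elements of `k`. -/
def repL (q : kˣ) (sqrt : kˣ → kˣ) (z : kˣ) (n : ℕ) (ε : ℤˣ) :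
    D q →ₐ[k] Module.End k (Fin (n + 1) → k) :=
  (repU q n ε).comp (piPlus q (sqrt z))

/-- The direct sum of the modules `L_z(m+n-2i, ε)` for `0 ≤ i ≤ min m n`. -/
def sumL (q : kˣ) (sqrt : kˣ → kˣ) (z : kˣ) (m n : ℕ) (ε : ℤˣ) :
    D q →ₐ[k] Module.End k (⨁ i : Fin (min m n + 1), (Fin (m + n - 2 * i + 1) → k)) :=
  directSumRep fun i => repL q sqrt z (m + n - 2 * i) ε

end QuantumDouble

end

/-!
The module `L_z(n, ε)` depends on `z` and `ε` only through the scalar `ε √z`, so all cases of the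
theorem say that `L(m, a) ⊗ L(n, b)` is the direct sum of the `L(m+n-2p, ab)` for
`0 ≤ p ≤ min m n`, where `a`, `b` and `ab` are such scalars (`tensorRep_repIso_sumL`).

For each `p` the tensor product contains an explicit nonzero highest weight vector
`∑ cᵢ mᵢ ⊗ m_{p-i}` on which `K` acts by `ab q^(m+n-2p)` (`hwVec_isHighestWeight`). In a
finite-dimensional module, a vector `v` with `E v = 0` and weight `c q^N` satisfies
`E F^(s+1) v = c [s+1] [N-s] F^s v`; since `q` is not a root of unity, this forces `F^(N+1) v = 0`,
and `m_s ↦ F^s v` is a homomorphism `L(N, c) → V` (`IsHighestWeight.exists_hom`). The sum of these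
homomorphisms is injective on the kernel of `E`, because the highest weight vectors belong to
different eigenvalues of `K`, and hence injective, because `E` is nilpotent
(`injective_of_nilpotent`). It is bijective, as the dimensions agree (`sum_dim`). No semisimplicity
theorem for `D_q` is needed.
-/

noncomputable section

namespace QuantumDouble

variable {k : Type*} [Field k]

theorem zpow_injective_of_not_root {q : kˣ} (hq : ∀ l : ℕ, 0 < l → q ^ l ≠ 1) :
    Function.Injective fun j : ℤ => (q : k) ^ j := by
  have h : ¬ IsOfFinOrder q := by
    rw [isOfFinOrder_iff_pow_eq_one]
    rintro ⟨l, hl, h⟩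
    exact hq l hl h
  intro i j hij
  apply injective_zpow_iff_not_isOfFinOrder.2 h
  ext
  simpa using hij

theorem qnum_ne_zero {q : kˣ} (hq : ∀ l : ℕ, 0 < l → q ^ l ≠ 1) {j : ℤ} (hj : j ≠ 0) :
    qnum q j ≠ 0 := by
  have hinj := zpow_injective_of_not_root hq
  refine div_ne_zero (sub_ne_zero.2 fun h => hj ?_) (sub_ne_zero.2 fun h => ?_)
  · have := hinj h
    omega
  · have := @hinj 1 (-1) (by simpa using h)
    omega

/-! ### The action on the modules `L_z(n, ε)` -/

section Action

variable (q : kˣ) (sqrt : kˣ → kˣ) (z : kˣ) (n : ℕ) (ε : ℤˣ)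

theorem repL_gen (g : DGen) :
    repL q sqrt z n ε (D.gen q g) = match g with
      | .E => (sqrt z : k) • actU q n ε .E
      | .F => actU q n ε .F
      | .K => (sqrt z : k) • actU q n ε .K
      | .Kinv => (sqrt z : k)⁻¹ • actU q n ε .Kinv
      | .Kt => (sqrt z : k)⁻¹ • actU q n ε .K
      | .Ktinv => (sqrt z : k) • actU q n ε .Kinv := by
  have h : ∀ g, repU q n ε (U.gen q g) = actU q n ε g := fun g => by
    unfold repU
    exact U.lift_gen ..
  unfold repL piPlus
  rw [AlgHom.comp_apply, D.lift_gen]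
  cases g <;> simp only [map_smul, h]

theorem repL_K_vec (i : ℕ) : repL q sqrt z n ε (D.gen q .K) (vec k n i) =
    (((ε : ℤ) : k) * sqrt z * (q : k) ^ ((n : ℤ) - 2 * i)) • vec k n i := by
  simp only [repL_gen, LinearMap.smul_apply, K_vec, smul_smul]
  congr 1
  ring

theorem sign_ne_zero : ((ε : ℤ) : k) ≠ 0 :=
  left_ne_zero_of_mul_eq_one (sign_mul_self ε)

theorem repL_Ktinv_vec (i : ℕ) : repL q sqrt z n ε (D.gen q .Ktinv) (vec k n i) =
    (((ε : ℤ) : k) * sqrt z * (q : k) ^ (-((n : ℤ) - 2 * i))) • vec k n i := by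
  simp only [repL_gen, LinearMap.smul_apply, Kinv_vec, smul_smul]
  congr 1
  ring

theorem repL_F_vec (i : ℕ) :
    repL q sqrt z n ε (D.gen q .F) (vec k n i) = vec k n (i + 1) := by
  simp only [repL_gen, F_vec]

theorem repL_E_vec_zero : repL q sqrt z n ε (D.gen q .E) (vec k n 0) = 0 := by
  simp only [repL_gen, LinearMap.smul_apply, E_vec_zero, smul_zero]

theorem repL_E_vec_succ (i : ℕ) : repL q sqrt z n ε (D.gen q .E) (vec k n (i + 1)) =
    (((ε : ℤ) : k) * sqrt z * (qnum q (i + 1) * qnum q (n - i))) • vec k n i := by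
  simp only [repL_gen, LinearMap.smul_apply, E_vec_succ, smul_smul]
  congr 1
  ring

theorem eq_sum_vec (x : Fin (n + 1) → k) : x = ∑ i : Fin (n + 1), x i • vec k n i := by
  conv_lhs => rw [← (Pi.basisFun k (Fin (n + 1))).sum_repr x]
  refine Finset.sum_congr rfl fun i _ => ?_
  rw [Pi.basisFun_repr, Pi.basisFun_apply, vec, dif_pos i.is_lt]

theorem repL_E_apply_castSucc (x : Fin (n + 1) → k) (i : Fin n) :
    repL q sqrt z n ε (D.gen q .E) x i.castSucc =
      ((ε : ℤ) : k) * sqrt z * (qnum q (i + 1) * qnum q (n - i)) * x i.succ := by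
  conv_lhs => rw [eq_sum_vec n x]
  rw [Fin.sum_univ_succ]
  simp only [map_add, map_sum, map_smul, Fin.val_zero, repL_E_vec_zero, smul_zero, zero_add,
    Fin.val_succ, repL_E_vec_succ, Finset.sum_apply, Pi.smul_apply]
  rw [Finset.sum_eq_single i]
  · simp [vec, Fin.castSucc, Fin.castAdd, Fin.castLE]
    ring
  · intro j _ hj
    have : (vec k n j) i.castSucc = 0 := by
      rw [vec, dif_pos (by omega), Pi.single_eq_of_ne]
      intro h
      exact hj (Fin.ext (by simpa using (congrArg Fin.val h).symm))
    simp [this]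
  · simp

theorem repL_E_apply_last (x : Fin (n + 1) → k) :
    repL q sqrt z n ε (D.gen q .E) x (Fin.last n) = 0 := by
  conv_lhs => rw [eq_sum_vec n x]
  rw [Fin.sum_univ_succ]
  simp only [map_add, map_sum, map_smul, Fin.val_zero, repL_E_vec_zero, smul_zero, zero_add,
    Fin.val_succ, repL_E_vec_succ, Finset.sum_apply, Pi.smul_apply]
  refine Finset.sum_eq_zero fun j _ => ?_
  have : (vec k n j) (Fin.last n) = 0 := by
    rw [vec, dif_pos (by omega), Pi.single_eq_of_ne]
    intro h
    have := congrArg Fin.val h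
    simp at this
    omega
  simp [this]

variable {q n}

/-- As `[i]_q` and `[n+1-i]_q` do not vanish for `1 ≤ i ≤ n`, the kernel of `E` on `L_z(n, ε)` is
spanned by `m_0`. -/
theorem repL_E_eq_zero (hq : ∀ l : ℕ, 0 < l → q ^ l ≠ 1) {x : Fin (n + 1) → k}
    (hx : repL q sqrt z n ε (D.gen q .E) x = 0) : x = x 0 • vec k n 0 := by
  funext j
  refine Fin.cases ?_ (fun i => ?_) j
  · simp [vec]
  · have h := congrFun hx i.castSucc
    rw [repL_E_apply_castSucc] at h
    have h1 : qnum q ((i : ℕ) + 1 : ℤ) ≠ 0 := qnum_ne_zero hq (by omega)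
    have h2 : qnum q ((n : ℤ) - (i : ℕ)) ≠ 0 := qnum_ne_zero hq (by omega)
    have h3 : x i.succ = 0 := by
      simpa [sign_ne_zero, h1, h2] using h
    simp [h3, vec]

variable (n) in
/-- `E` shifts coordinates down by one, so `E^t` has no coordinate beyond `n - t`. -/
theorem repL_E_pow_apply (t : ℕ) (x : Fin (n + 1) → k) (i : Fin (n + 1)) (h : n < i + t) :
    (repL q sqrt z n ε (D.gen q .E) ^ t) x i = 0 := by
  induction t generalizing i with
  | zero => omega
  | succ t ih =>
    rw [pow_succ', Module.End.mul_apply]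
    induction i using Fin.lastCases with
    | last => exact repL_E_apply_last ..
    | cast i =>
      rw [repL_E_apply_castSucc, ih _ (by simp at h ⊢; omega), mul_zero]

end Action

/-! ### Highest weight vectors and homomorphisms out of `L_z(n, ε)` -/

section HighestWeight

variable {q : kˣ} {V : Type*} [AddCommGroup V] [Module k V] (ρ : D q →ₐ[k] Module.End k V)

theorem rep_E_F (x : V) : ρ (D.gen q .E) (ρ (D.gen q .F) x) =
    ρ (D.gen q .F) (ρ (D.gen q .E) x) +
      ((q : k) - (q : k)⁻¹)⁻¹ • (ρ (D.gen q .K) x - ρ (D.gen q .Ktinv) x) := by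
  have h := LinearMap.congr_fun (congrArg ρ (D.EF (q := q))) x
  simp only [map_sub, map_mul, map_smul, LinearMap.sub_apply, Module.End.mul_apply,
    LinearMap.smul_apply] at h
  rw [← h]
  abel

theorem rep_K_F (x : V) : ρ (D.gen q .K) (ρ (D.gen q .F) x) =
    (q : k) ^ (-2 : ℤ) • ρ (D.gen q .F) (ρ (D.gen q .K) x) := by
  simpa only [map_mul, map_smul, Module.End.mul_apply, LinearMap.smul_apply] using
    LinearMap.congr_fun (congrArg ρ (D.KF (q := q))) x

theorem rep_Ktinv_F (x : V) : ρ (D.gen q .Ktinv) (ρ (D.gen q .F) x) =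
    (q : k) ^ (2 : ℤ) • ρ (D.gen q .F) (ρ (D.gen q .Ktinv) x) := by
  have h := LinearMap.congr_fun (congrArg ρ (D.mul_Ktinv (D.KtF (q := q)))) x
  simp only [map_mul, map_smul, Module.End.mul_apply, LinearMap.smul_apply] at h
  rw [h, smul_smul, ← zpow_add₀ q.ne_zero]
  simp

/-- `v` is annihilated by `E`, and `K` and `K̃⁻¹` act on it by `c q^N` and `c q^{-N}`, as they do on
the vector `m_0` of `L_z(N, ε)` when `c = ε √z`. The vector `v` may be zero. -/
structure IsHighestWeight (c : k) (N : ℕ) (v : V) : Prop where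
  E : ρ (D.gen q .E) v = 0
  K : ρ (D.gen q .K) v = (c * (q : k) ^ (N : ℤ)) • v
  Ktinv : ρ (D.gen q .Ktinv) v = (c * (q : k) ^ (-(N : ℤ))) • v

variable {ρ} {c : k} {N : ℕ} {v : V}

namespace IsHighestWeight

theorem K_F_pow (h : IsHighestWeight ρ c N v) (s : ℕ) :
    ρ (D.gen q .K) ((ρ (D.gen q .F) ^ s) v) =
      (c * (q : k) ^ ((N : ℤ) - 2 * s)) • (ρ (D.gen q .F) ^ s) v := by
  induction s with
  | zero => simpa using h.K
  | succ s ih =>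
    rw [pow_succ', Module.End.mul_apply, rep_K_F, ih, map_smul, smul_smul]
    congr 1
    rw [show (N : ℤ) - 2 * ((s + 1 : ℕ) : ℤ) = (N - 2 * (s : ℤ)) + (-2) by push_cast; ring,
      zpow_add₀ q.ne_zero]
    ring

theorem Ktinv_F_pow (h : IsHighestWeight ρ c N v) (s : ℕ) :
    ρ (D.gen q .Ktinv) ((ρ (D.gen q .F) ^ s) v) =
      (c * (q : k) ^ (-((N : ℤ) - 2 * s))) • (ρ (D.gen q .F) ^ s) v := by
  induction s with
  | zero => simpa using h.Ktinv
  | succ s ih =>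
    rw [pow_succ', Module.End.mul_apply, rep_Ktinv_F, ih, map_smul, smul_smul]
    congr 1
    rw [show -((N : ℤ) - 2 * ((s + 1 : ℕ) : ℤ)) = -(N - 2 * (s : ℤ)) + 2 by push_cast; ring,
      zpow_add₀ q.ne_zero]
    ring

theorem E_F_pow_succ (h : IsHighestWeight ρ c N v) (s : ℕ) :
    ρ (D.gen q .E) ((ρ (D.gen q .F) ^ (s + 1)) v) =
      (c * (qnum q (s + 1) * qnum q (N - s))) • (ρ (D.gen q .F) ^ s) v := by
  have key (s : ℕ) := qnum_identity q (N : ℤ) s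
  have step (s : ℕ) : ρ (D.gen q .E) ((ρ (D.gen q .F) ^ (s + 1)) v) =
      ρ (D.gen q .F) (ρ (D.gen q .E) ((ρ (D.gen q .F) ^ s) v)) +
      (c * (qnum q (s + 1) * qnum q (N - s) - qnum q s * qnum q (N + 1 - s))) •
        (ρ (D.gen q .F) ^ s) v := by
    rw [pow_succ', Module.End.mul_apply, rep_E_F, h.K_F_pow, h.Ktinv_F_pow, key, ← sub_smul,
      smul_smul]
    congr 2
    ring
  induction s with
  | zero => rw [step]; simp [h.E, qnum]
  | succ s ih =>
    rw [step, ih, map_smul, ← Module.End.mul_apply, ← pow_succ', ← add_smul]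
    congr 1
    push_cast
    rw [show (N : ℤ) + 1 - (s + 1) = N - s by ring]
    ring

/-- On a finite-dimensional module `F` acts nilpotently on `v`, since the nonzero vectors `F^s v`
belong to pairwise different eigenvalues of `K`. If `F^s v` is the last nonzero one, then
`0 = E F^{s+1} v = c [s+1] [N-s] F^s v` forces `s = N`. -/
theorem F_pow_succ_eq_zero [FiniteDimensional k V] (hq : ∀ l : ℕ, 0 < l → q ^ l ≠ 1) (hc : c ≠ 0)
    (h : IsHighestWeight ρ c N v) : (ρ (D.gen q .F) ^ (N + 1)) v = 0 := by
  classical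
  have hinj := zpow_injective_of_not_root hq
  have hnil : ∃ s, (ρ (D.gen q .F) ^ s) v = 0 := by
    by_contra! hne
    have hμ : Function.Injective fun s : ℕ => c * (q : k) ^ ((N : ℤ) - 2 * s) := fun s t hst => by
      have := hinj (mul_left_cancel₀ hc hst)
      omega
    have := Module.End.eigenvectors_linearIndependent' (ρ (D.gen q .K)) _ hμ
      (fun s => (ρ (D.gen q .F) ^ s) v)
      fun s => Module.End.hasEigenvector_iff.2 ⟨Module.End.mem_eigenspace_iff.2 (h.K_F_pow s), hne s⟩
    exact not_finite_iff_infinite.2 inferInstance this.finite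
  have hmin := @Nat.find_min _ _ hnil
  have hz := Nat.find_spec hnil
  generalize Nat.find hnil = t at hmin hz
  rcases t with _ | s
  · have : v = 0 := by simpa using hz
    simp [this]
  · have hE := h.E_F_pow_succ s
    rw [hz, map_zero, eq_comm, smul_eq_zero_iff_left (hmin s.lt_succ_self), mul_eq_zero,
      mul_eq_zero] at hE
    have h1 : qnum q ((s : ℤ) + 1) ≠ 0 := qnum_ne_zero hq (by omega)
    have h2 : (N : ℤ) - s = 0 := by
      by_contra h2
      exact (hE.resolve_left hc).elim h1 (qnum_ne_zero hq h2)
    obtain rfl : N = s := by omega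
    exact hz

end IsHighestWeight

theorem intertwines_inv {W : Type*} [AddCommGroup W] [Module k W] (φ : W →ₗ[k] V)
    {S S' : Module.End k W} {T T' : Module.End k V} (hS : S * S' = 1) (hT : T' * T = 1)
    (h : ∀ x, φ (S x) = T (φ x)) (x : W) : φ (S' x) = T' (φ x) := by
  have h1 : S (S' x) = x := LinearMap.congr_fun hS x
  have h2 (y : V) : T' (T y) = y := LinearMap.congr_fun hT y
  rw [← h2 (φ (S' x)), ← h, h1]

/-- To commute with `D_q` it suffices to commute with `E`, `F`, `K` and `K̃⁻¹`. -/
theorem intertwines_of_gen {W : Type*} [AddCommGroup W] [Module k W]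
    {σ : D q →ₐ[k] Module.End k W} (φ : W →ₗ[k] V)
    (hE : ∀ x, φ (σ (D.gen q .E) x) = ρ (D.gen q .E) (φ x))
    (hF : ∀ x, φ (σ (D.gen q .F) x) = ρ (D.gen q .F) (φ x))
    (hK : ∀ x, φ (σ (D.gen q .K) x) = ρ (D.gen q .K) (φ x))
    (hKt : ∀ x, φ (σ (D.gen q .Ktinv) x) = ρ (D.gen q .Ktinv) (φ x))
    (a : D q) (x : W) : φ (σ a x) = ρ a (φ x) := by
  have hgen (g : DGen) (x : W) : φ (σ (D.gen q g) x) = ρ (D.gen q g) (φ x) := by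
    cases g with
    | E => exact hE x
    | F => exact hF x
    | K => exact hK x
    | Ktinv => exact hKt x
    | Kinv =>
      exact intertwines_inv φ (by rw [← map_mul, D.K_Kinv, map_one])
        (by rw [← map_mul, D.Kinv_K, map_one]) hK x
    | Kt =>
      exact intertwines_inv φ (by rw [← map_mul, D.Ktinv_Kt, map_one])
        (by rw [← map_mul, D.Kt_Ktinv, map_one]) hKt x
  obtain ⟨a, rfl⟩ : ∃ b, D.mk q b = a := RingQuot.mkAlgHom_surjective k (DRel q) a
  induction a using FreeAlgebra.induction generalizing x with
  | grade0 r => simp [Algebra.algebraMap_eq_smul_one]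
  | grade1 g => exact hgen g x
  | mul a b ha hb => simp only [map_mul, Module.End.mul_apply, ha, hb]
  | add a b ha hb => simp only [map_add, LinearMap.add_apply, ha, hb]

theorem intertwines_of_vec {n : ℕ} (φ : (Fin (n + 1) → k) →ₗ[k] V)
    {S : Module.End k (Fin (n + 1) → k)} {T : Module.End k V}
    (h : ∀ i, φ (S (vec k n i)) = T (φ (vec k n i))) (x) : φ (S x) = T (φ x) := by
  rw [eq_sum_vec n x]
  simp only [map_sum, map_smul, h]

/-- A highest weight vector `v` induces the homomorphism `m_s ↦ F^s v`. -/
theorem IsHighestWeight.exists_hom [FiniteDimensional k V] (hq : ∀ l : ℕ, 0 < l → q ^ l ≠ 1)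
    {sqrt : kˣ → kˣ} {z : kˣ} {ε : ℤˣ} (h : IsHighestWeight ρ (((ε : ℤ) : k) * sqrt z) N v) :
    ∃ φ : (Fin (N + 1) → k) →ₗ[k] V, φ (vec k N 0) = v ∧
      ∀ a x, φ (repL q sqrt z N ε a x) = ρ a (φ x) := by
  have hc : ((ε : ℤ) : k) * sqrt z ≠ 0 := mul_ne_zero (sign_ne_zero ε) (sqrt z).ne_zero
  have hz := h.F_pow_succ_eq_zero hq hc
  set φ : (Fin (N + 1) → k) →ₗ[k] V :=
    (Pi.basisFun k (Fin (N + 1))).constr k fun i => (ρ (D.gen q .F) ^ (i : ℕ)) v with hφ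
  have hvec (i : ℕ) : φ (vec k N i) = (ρ (D.gen q .F) ^ i) v := by
    rcases lt_or_ge i (N + 1) with hi | hi
    · have h : vec k N i = Pi.basisFun k (Fin (N + 1)) ⟨i, hi⟩ := by simp [vec, hi]
      rw [h, hφ, Module.Basis.constr_basis]
    · obtain ⟨j, rfl⟩ := Nat.exists_eq_add_of_le' hi
      rw [vec_of_lt (by omega), map_zero, pow_add, Module.End.mul_apply, hz, map_zero]
  refine ⟨φ, by simpa using hvec 0, intertwines_of_gen φ ?_ ?_ ?_ ?_⟩ <;>
    refine intertwines_of_vec φ fun i => ?_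
  · rcases i with _ | i
    · rw [repL_E_vec_zero, hvec, map_zero, pow_zero, Module.End.one_apply, h.E]
    · rw [repL_E_vec_succ, map_smul, hvec, hvec, h.E_F_pow_succ]
  · rw [repL_F_vec, hvec, hvec, pow_succ', Module.End.mul_apply]
  · rw [repL_K_vec, map_smul, hvec, h.K_F_pow]
  · rw [repL_Ktinv_vec, map_smul, hvec, h.Ktinv_F_pow]

end HighestWeight

/-! ### Highest weight vectors in tensor products -/

section Tensor

variable {q : kˣ} {V W : Type*} [AddCommGroup V] [Module k V] [AddCommGroup W] [Module k W]
  (ρ : D q →ₐ[k] Module.End k V) (σ : D q →ₐ[k] Module.End k W)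

theorem tensorRep_gen (g : DGen) : tensorRep ρ σ (D.gen q g) =
    Module.endTensorEndAlgHom (R := k) (S := k) (A := k)
      (Algebra.TensorProduct.map ρ σ (D.comulGen q g)) := by
  rw [← D.comul_gen]
  rfl

theorem tensorRep_E (x : V) (y : W) : tensorRep ρ σ (D.gen q .E) (x ⊗ₜ y) =
    ρ (D.gen q .E) x ⊗ₜ y + ρ (D.gen q .K) x ⊗ₜ σ (D.gen q .E) y := by
  simp [tensorRep_gen, D.comulGen, Module.endTensorEndAlgHom_apply]

theorem tensorRep_K (x : V) (y : W) : tensorRep ρ σ (D.gen q .K) (x ⊗ₜ y) =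
    ρ (D.gen q .K) x ⊗ₜ σ (D.gen q .K) y := by
  simp [tensorRep_gen, D.comulGen, Module.endTensorEndAlgHom_apply]

theorem tensorRep_Ktinv (x : V) (y : W) : tensorRep ρ σ (D.gen q .Ktinv) (x ⊗ₜ y) =
    ρ (D.gen q .Ktinv) x ⊗ₜ σ (D.gen q .Ktinv) y := by
  simp [tensorRep_gen, D.comulGen, Module.endTensorEndAlgHom_apply]

/-- The coefficients of the highest weight vector of degree `p` in `L_z(m, ε) ⊗ L_{z'}(n, ε')`,
where `b = ε' √z'`. The recursion says that `E` annihilates `∑ cᵢ mᵢ ⊗ m_{p-i}`; only the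
coefficients with `i ≤ p` matter, and for these the denominators are nonzero when `p ≤ m`. -/
def hwCoeff (q : kˣ) (b : k) (m n p : ℕ) : ℕ → k
  | 0 => 1
  | i + 1 => -(b * (q : k) ^ ((m : ℤ) - 2 * i) * (qnum q (p - i) * qnum q (n + 1 - p + i))) /
      (qnum q (i + 1) * qnum q (m - i)) * hwCoeff q b m n p i

/-- The vector `∑ cᵢ mᵢ ⊗ m_{p-i}` in `L_z(m, ε) ⊗ L_{z'}(n, ε')`. -/
def hwVec (q : kˣ) (b : k) (m n p : ℕ) : (Fin (m + 1) → k) ⊗[k] (Fin (n + 1) → k) :=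
  ∑ i ∈ Finset.range (p + 1), hwCoeff q b m n p i • (vec k m i ⊗ₜ vec k n (p - i))

theorem hwVec_ne_zero (q : kˣ) (b : k) {m n p : ℕ} (hn : p ≤ n) : hwVec q b m n p ≠ 0 := by
  intro h
  -- The coordinate of `m_0 ⊗ m_p` is `c₀ = 1`.
  have h' := congrArg ((TensorProduct.lid k k).toLinearMap ∘ₗ
    TensorProduct.map (LinearMap.proj (0 : Fin (m + 1)))
      (LinearMap.proj (⟨p, by omega⟩ : Fin (n + 1)))) h
  rw [hwVec, map_sum, Finset.sum_eq_single 0] at h'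
  · simp [vec, hwCoeff, hn] at h'
  · intro i _ hi
    have : vec k m i 0 = 0 := by
      unfold vec
      split_ifs with h
      · rw [Pi.single_eq_of_ne]
        exact fun h => hi (congrArg Fin.val h).symm
      · rfl
    simp [this]
  · simp

theorem hwVec_isHighestWeight (hq : ∀ l : ℕ, 0 < l → q ^ l ≠ 1) (sqrt : kˣ → kˣ) (z z' : kˣ)
    (ε ε' : ℤˣ) {m n p : ℕ} (hm : p ≤ m) (hn : p ≤ n) :
    IsHighestWeight (tensorRep (repL q sqrt z m ε) (repL q sqrt z' n ε'))
      (((ε : ℤ) : k) * sqrt z * (((ε' : ℤ) : k) * sqrt z')) (m + n - 2 * p)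
      (hwVec q (((ε' : ℤ) : k) * sqrt z') m n p) where
  E := by
    simp only [hwVec, map_sum, map_smul, tensorRep_E, smul_add, Finset.sum_add_distrib]
    -- Drop the terms with `E m_0 = 0`: `i = 0` from the first sum, `i = p` from the second.
    rw [Finset.sum_range_succ', Finset.sum_range_succ]
    simp only [repL_E_vec_zero, TensorProduct.zero_tmul, smul_zero, add_zero, Nat.sub_self,
      TensorProduct.tmul_zero, ← Finset.sum_add_distrib]
    -- The coefficient of `m_i ⊗ m_{p-1-i}`, which comes from the summands `i + 1` and `i`.
    refine Finset.sum_eq_zero fun i hi => ?_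
    have hi : i < p := Finset.mem_range.1 hi
    obtain ⟨j, rfl⟩ := Nat.exists_eq_add_of_le hi
    have h1 : qnum q ((i : ℤ) + 1) ≠ 0 := qnum_ne_zero hq (by omega)
    have h2 : qnum q ((m : ℤ) - i) ≠ 0 := qnum_ne_zero hq (by omega)
    rw [show i + 1 + j - (i + 1) = j by omega, show i + 1 + j - i = j + 1 by omega,
      repL_E_vec_succ, repL_E_vec_succ, repL_K_vec, TensorProduct.smul_tmul_smul,
      ← TensorProduct.smul_tmul', smul_smul, smul_smul, ← add_smul]
    convert zero_smul k _
    rw [hwCoeff]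
    push_cast
    rw [show (i : ℤ) + 1 + j - i = j + 1 by ring, show (n : ℤ) + 1 - (i + 1 + j) + i = n - j by ring]
    field_simp
    ring
  K := by
    simp only [hwVec, map_sum, Finset.smul_sum, map_smul, tensorRep_K, repL_K_vec,
      TensorProduct.smul_tmul_smul]
    refine Finset.sum_congr rfl fun i hi => ?_
    have hi : i ≤ p := Nat.lt_succ_iff.1 (Finset.mem_range.1 hi)
    rw [smul_comm]
    congr 1
    rw [show ((m + n - 2 * p : ℕ) : ℤ) = ((m : ℤ) - 2 * i) + (n - 2 * (p - i : ℕ)) by omega,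
      zpow_add₀ q.ne_zero]
    ring
  Ktinv := by
    simp only [hwVec, map_sum, Finset.smul_sum, map_smul, tensorRep_Ktinv, repL_Ktinv_vec,
      TensorProduct.smul_tmul_smul]
    refine Finset.sum_congr rfl fun i hi => ?_
    have hi : i ≤ p := Nat.lt_succ_iff.1 (Finset.mem_range.1 hi)
    rw [smul_comm]
    congr 1
    rw [show -((m + n - 2 * p : ℕ) : ℤ) = -((m : ℤ) - 2 * i) + -(n - 2 * (p - i : ℕ)) by omega,
      zpow_add₀ q.ne_zero]
    ring

end Tensor

/-! ### The decomposition -/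

section Decomposition

/-- A nonzero kernel of `φ` would be stable under `S`, and would thus meet the kernel of the
nilpotent map `S` nontrivially. -/
theorem injective_of_nilpotent {V W : Type*} [AddCommGroup V] [Module k V] [AddCommGroup W]
    [Module k W] {S : Module.End k V} {T : Module.End k W} (φ : V →ₗ[k] W)
    (h : ∀ x, φ (S x) = T (φ x)) (hS : IsNilpotent S) (hker : ∀ x, S x = 0 → φ x = 0 → x = 0) :
    Function.Injective φ := by
  obtain ⟨t, ht⟩ := hS
  have key (t : ℕ) : ∀ x, (S ^ t) x = 0 → φ x = 0 → x = 0 := by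
    induction t with
    | zero => exact fun x hx _ => by simpa using hx
    | succ t ih =>
      intro x hx hφ
      refine hker x (ih (S x) ?_ ?_) hφ
      · rwa [pow_succ, Module.End.mul_apply] at hx
      · rw [h, hφ, map_zero]
  exact (injective_iff_map_eq_zero φ).2 fun x => key t x (by simp [ht])

theorem sum_dim (m n : ℕ) :
    ∑ i : Fin (min m n + 1), (m + n - 2 * i + 1) = (m + 1) * (n + 1) := by
  -- With `l` the smaller and `l + d` the larger of `m` and `n`.
  have key (l d : ℕ) : ∀ r ≤ l, ∑ i ∈ Finset.range (r + 1), (l + (l + d) - 2 * i + 1) =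
      (r + 1) * (2 * l + d + 1 - r) := by
    intro r hr
    induction r with
    | zero => simp; ring
    | succ r ih =>
      rw [Finset.sum_range_succ, ih (by omega)]
      obtain ⟨e, rfl⟩ := Nat.exists_eq_add_of_le hr
      rw [show r + 1 + e + (r + 1 + e + d) - 2 * (r + 1) + 1 = 2 * e + d + 1 by omega,
        show 2 * (r + 1 + e) + d + 1 - r = r + 2 * e + d + 3 by omega,
        show 2 * (r + 1 + e) + d + 1 - (r + 1) = r + 2 * e + d + 2 by omega]
      ring
  rw [Fin.sum_univ_eq_sum_range fun i => m + n - 2 * i + 1]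
  rcases le_total m n with h | h
  · obtain ⟨d, rfl⟩ := Nat.exists_eq_add_of_le h
    rw [min_eq_left h, key m d m le_rfl, show 2 * m + d + 1 - m = m + d + 1 by omega]
  · obtain ⟨d, rfl⟩ := Nat.exists_eq_add_of_le h
    rw [min_eq_right h, add_comm (n + d) n, key n d n le_rfl,
      show 2 * n + d + 1 - n = n + d + 1 by omega]
    ring

theorem directSumRep_apply {A : Type*} [Ring A] [Algebra k A] {ι : Type*} {V : ι → Type*}
    [∀ i, AddCommGroup (V i)] [∀ i, Module k (V i)] (ρ : ∀ i, A →ₐ[k] Module.End k (V i)) (a : A)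
    (x : ⨁ i, V i) (i : ι) : directSumRep ρ a x i = ρ i a (x i) := by
  simp [directSumRep, DirectSum.lmap_apply]

theorem directSumRep_of {A : Type*} [Ring A] [Algebra k A] {ι : Type*} [DecidableEq ι]
    {V : ι → Type*} [∀ i, AddCommGroup (V i)] [∀ i, Module k (V i)]
    (ρ : ∀ i, A →ₐ[k] Module.End k (V i)) (a : A) (i : ι) (x : V i) :
    directSumRep ρ a (DirectSum.lof k ι V i x) = DirectSum.lof k ι V i (ρ i a x) := by
  simp [directSumRep, DirectSum.lmap_lof]

theorem RepIso.symm {A V W : Type*} [Ring A] [Algebra k A] [AddCommGroup V] [Module k V]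
    [AddCommGroup W] [Module k W] {ρ : A →ₐ[k] Module.End k V} {σ : A →ₐ[k] Module.End k W} :
    RepIso ρ σ → RepIso σ ρ := by
  rintro ⟨e, he⟩
  exact ⟨e.symm, fun a v => e.injective (by simp [he])⟩

variable {q : kˣ} (sqrt : kˣ → kˣ) (z : kˣ) (m n : ℕ) (ε : ℤˣ)

theorem isNilpotent_sumL_E : IsNilpotent (sumL q sqrt z m n ε (D.gen q .E)) := by
  refine ⟨m + n + 1, ?_⟩
  have h (t : ℕ) (x) (i) : (sumL q sqrt z m n ε (D.gen q .E) ^ t) x i =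
      (repL q sqrt z (m + n - 2 * i) ε (D.gen q .E) ^ t) (x i) := by
    rw [← map_pow, ← map_pow]
    exact directSumRep_apply ..
  refine LinearMap.ext fun x => DFinsupp.ext fun i => ?_
  rw [h]
  exact funext fun j => repL_E_pow_apply _ _ _ _ _ _ _ (by omega)

variable {z m n ε}

/-- A module of dimension `(m+1)(n+1)` with nonzero highest weight vectors `v i` of the highest
weights of the summands of `sumL` is isomorphic to `sumL`. -/
theorem repIso_sumL (hq : ∀ l : ℕ, 0 < l → q ^ l ≠ 1) {V : Type*} [AddCommGroup V] [Module k V]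
    [FiniteDimensional k V] {ρ : D q →ₐ[k] Module.End k V}
    (hV : Module.finrank k V = (m + 1) * (n + 1))
    (v : Fin (min m n + 1) → V) (hv : ∀ i, v i ≠ 0)
    (hw : ∀ i : Fin (min m n + 1), IsHighestWeight ρ (((ε : ℤ) : k) * sqrt z) (m + n - 2 * i) (v i)) :
    RepIso ρ (sumL q sqrt z m n ε) := by
  choose φ hφv hφ using fun i : Fin (min m n + 1) => (hw i).exists_hom hq
  set Φ := DirectSum.toModule k (Fin (min m n + 1)) V φ with hΦ
  have hΦρ (a) (x) : Φ (sumL q sqrt z m n ε a x) = ρ a (Φ x) := by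
    have : Φ ∘ₗ sumL q sqrt z m n ε a = ρ a ∘ₗ Φ := by
      refine DirectSum.linearMap_ext k fun i => LinearMap.ext fun x => ?_
      simp only [LinearMap.comp_apply, sumL, directSumRep_of, hΦ, DirectSum.toModule_lof, hφ]
    exact LinearMap.congr_fun this x
  have hc : ((ε : ℤ) : k) * sqrt z ≠ 0 := mul_ne_zero (sign_ne_zero ε) (sqrt z).ne_zero
  have hli : LinearIndependent k v := by
    refine Module.End.eigenvectors_linearIndependent' (ρ (D.gen q .K)) _ (fun i j hij => ?_) v
      fun i => Module.End.hasEigenvector_iff.2 ⟨Module.End.mem_eigenspace_iff.2 (hw i).K, hv i⟩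
    have := zpow_injective_of_not_root hq (mul_left_cancel₀ hc hij)
    omega
  -- The kernel of `E` on the direct sum is spanned by the vectors `m_0` of the summands, which `Φ`
  -- maps to the linearly independent `v i`.
  have hinj : Function.Injective Φ := by
    refine injective_of_nilpotent Φ (hΦρ (D.gen q .E)) (isNilpotent_sumL_E ..) fun x hx hΦx => ?_
    have hxi (i) : x i = x i 0 • vec k _ 0 := by
      refine repL_E_eq_zero sqrt z ε hq ?_
      rw [← directSumRep_apply (fun i : Fin (min m n + 1) => repL q sqrt z (m + n - 2 * i) ε)]
      exact DFunLike.congr_fun hx i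
    have hsum : ∑ i, x i 0 • v i = 0 := by
      rw [← hΦx, ← DirectSum.sum_univ_of x, map_sum]
      refine Finset.sum_congr rfl fun i _ => ?_
      rw [DirectSum.sum_univ_of]
      conv_rhs => rw [hxi i]
      rw [← hφv i, ← map_smul]
      exact (DirectSum.toModule_lof k (φ := φ) i _).symm
    refine DFinsupp.ext fun i => ?_
    rw [hxi i, Fintype.linearIndependent_iff.1 hli _ hsum i, zero_smul]
    rfl
  refine RepIso.symm ⟨LinearEquiv.ofInjectiveOfFinrankEq Φ hinj ?_, fun a x => hΦρ a x⟩
  rw [hV, Module.finrank_directSum, ← sum_dim]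
  simp

/-- `L_z(n, ε)` depends on `z` and `ε` only through `ε √z`, and in tensor products these scalars
multiply. -/
theorem tensorRep_repIso_sumL (hq : ∀ l : ℕ, 0 < l → q ^ l ≠ 1) {z' z'' : kˣ} {ε' ε'' : ℤˣ}
    (h : ((ε : ℤ) : k) * sqrt z * (((ε' : ℤ) : k) * sqrt z') = ((ε'' : ℤ) : k) * sqrt z'') :
    RepIso (tensorRep (repL q sqrt z m ε) (repL q sqrt z' n ε')) (sumL q sqrt z'' m n ε'') := by
  refine repIso_sumL sqrt hq (by simp) (fun i => hwVec q (((ε' : ℤ) : k) * sqrt z') m n i)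
    (fun i => hwVec_ne_zero q _ (by omega)) fun i => ?_
  rw [← h]
  have hi := i.is_lt
  exact hwVec_isHighestWeight hq sqrt z z' ε ε' (by omega) (by omega)

end Decomposition

end QuantumDouble

end

theorem theorem3p8 {k : Type*} [Field k] [IsAlgClosed k]
    (q : kˣ) (hq : ∀ l : ℕ, 0 < l → q ^ l ≠ 1)
    (sqrt : kˣ → kˣ) (hsqrt : ∀ z : kˣ, sqrt z ^ 2 = z)
    (z z' : kˣ) (m n : ℕ) :
    (sqrt z * sqrt z' = sqrt (z * z') → ∀ ε : ℤˣ,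
      QuantumDouble.RepIso
        (QuantumDouble.tensorRep (QuantumDouble.repL q sqrt z m ε)
          (QuantumDouble.repL q sqrt z' n ε))
        (QuantumDouble.sumL q sqrt (z * z') m n 1) ∧
      QuantumDouble.RepIso
        (QuantumDouble.tensorRep (QuantumDouble.repL q sqrt z m ε)
          (QuantumDouble.repL q sqrt z' n (-ε)))
        (QuantumDouble.sumL q sqrt (z * z') m n (-1))) ∧
    (sqrt z * sqrt z' = -sqrt (z * z') → ∀ ε : ℤˣ,
      QuantumDouble.RepIso
        (QuantumDouble.tensorRep (QuantumDouble.repL q sqrt z m ε)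
          (QuantumDouble.repL q sqrt z' n ε))
        (QuantumDouble.sumL q sqrt (z * z') m n (-1)) ∧
      QuantumDouble.RepIso
        (QuantumDouble.tensorRep (QuantumDouble.repL q sqrt z m ε)
          (QuantumDouble.repL q sqrt z' n (-ε)))
        (QuantumDouble.sumL q sqrt (z * z') m n 1)) := by

  have key : ∀ {s t u : kˣ} {e₁ e₂ e : ℤˣ}, s * t = u → e₁ * e₂ = e →
      ((e₁ : ℤ) : k) * s * (((e₂ : ℤ) : k) * t) = ((e : ℤ) : k) * u := by
    rintro s t _ e₁ e₂ _ rfl rfl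
    push_cast
    ring
  have key' : ∀ {s t u : kˣ} {e₁ e₂ e : ℤˣ}, s * t = -u → e₁ * e₂ = -e →
      ((e₁ : ℤ) : k) * s * (((e₂ : ℤ) : k) * t) = ((e : ℤ) : k) * u := fun h h' => by
    rw [key h h']
    simp
  refine ⟨fun h ε => ⟨?_, ?_⟩, fun h ε => ⟨?_, ?_⟩⟩ <;>
    refine QuantumDouble.tensorRep_repIso_sumL sqrt hq ?_
  · exact key h (by simp)
  · exact key h (by simp)
  · exact key' h (by simp)
  · exact key' h (by simp)
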